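/- Let $\Sigma$ be a finite alphabet and $d\in\mathbb N$. An ($\varepsilon$-free) $d$-dimensional vector addition system with states ($d$-VASS) over $\Sigma$ is a tuple $V=(\Sigma,Q,\delta,I,F)$ with a finite set $Q$ of states, a finite set of transitions $\delta\subseteq Q\times\Sigma\times\mathbb Z^d\times Q$, and finite sets $I,F\subseteq Q\times\mathbb N^d$ of initial and final configurations. A transition $(s,x,e,s')\in\delta$, which reads the letter $x$, can be fired in a configuration $(q,u)\in Q\times\mathbb N^d$ if $q=s$ and $u+e\ge 0$, and then leads to $(s',u+e)$. A run is a finite sequence of transitions that can be fired one after another from some configuration, and it reads the word formed by the letters of its transitions. A run is accepting if it can be fired starting from some configuration in $I$ so that it ends in a configuration $(q,u)$ for which there is $(q,f)\in F$ with $f\le u$ componentwise. The language $L(V)\subseteq\Sigma^*$ is the set of all words read by accepting runs; $V$ recognises $L$ if $L(V)=L$. For $k\in\mathbb N$, $V$ is $k$-ambiguous if every word $w\in L(V)$ is read by at most $k$ accepting runs. Let $a,b\in\Sigma$ be distinct letters, let $k,n\in\mathbb N$, and let $L\subseteq\{a,b\}^*$ be a language that is recognised by a $k$-ambiguous VASS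 over $\Sigma$ (of some dimension $d$) and such that every word of $L$ contains exactly $n$ letters $b$. Then the set $$im(L)=\{(a_1,\dots,a_{n+1})\in\mathbb N^{n+1}\;:\;a^{a_1}ba^{a_2}b\cdots ba^{a_{n+1}}\in L\}$$ is semilinear, i.e. it is a finite union of linear sets $\{p_0+m_1p_1+\dots+m_rp_r : m_1,\dots,m_r\in\mathbb N\}$, where $r\in\mathbb N$ and $p_0,p_1,\dots,p_r\in\mathbb N^{n+1}$. -/

import Mathlib

universe u v

/-- A transition `(s, x, e, s')` of a `d`-dimensional VASS with states `Q` over the alphabet `α`;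
the label `none` stands for the empty word `ε`. -/
structure VASS.Transition (d : ℕ) (α : Type u) (Q : Type v) where
  src : Q
  label : Option α
  eff : Fin d → ℤ
  tgt : Q

/-- A configuration `q(u)`: a state together with a vector of natural numbers. -/
abbrev VASS.Config (d : ℕ) (Q : Type v) : Type v := Q × (Fin d → ℕ)

/-- A `d`-dimensional vector addition system with states `(Σ, Q, δ, I, F)`. -/
structure VASS (d : ℕ) (α : Type u) (Q : Type v) where
  /-- the finite transition relation -/
  δ : Finset (VASS.Transition d α Q)
  /-- the finite set of initial configurations -/
  I : Finset (VASS.Config d Q)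
  /-- the finite set of final configurations -/
  F : Finset (VASS.Config d Q)

namespace VASS

/-- Firing `t` in the configuration `c` is possible and leads to `c'`. Nonnegativity of the
counters after the firing is expressed by `c'` having natural-number entries. -/
def Transition.Fires {d : ℕ} {α : Type u} {Q : Type v} (t : Transition d α Q)
    (c c' : Config d Q) : Prop :=
  c.1 = t.src ∧ c'.1 = t.tgt ∧ ∀ i, (c'.2 i : ℤ) = (c.2 i : ℤ) + t.eff i

/-- `V.RunFrom c ρ c'`: the sequence `ρ` of transitions of `V` can be fired one after another from
the configuration `c`, and this ends in `c'`. -/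
inductive RunFrom {d : ℕ} {α : Type u} {Q : Type v} (V : VASS d α Q) :
    Config d Q → List (Transition d α Q) → Config d Q → Prop
  | nil (c : Config d Q) : RunFrom V c [] c
  | cons {c c' c'' : Config d Q} {t : Transition d α Q} {ρ : List (Transition d α Q)}
      (ht : t ∈ V.δ) (hf : t.Fires c c') (hρ : RunFrom V c' ρ c'') : RunFrom V c (t :: ρ) c''

/-- The word read by a sequence of transitions (labels `ε` are erased). -/
def word {d : ℕ} {α : Type u} {Q : Type v} (ρ : List (Transition d α Q)) : List α :=
  ρ.filterMap Transition.label

/-- A configuration is accepting if it covers some final configuration. -/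
def IsAcceptingConfig {d : ℕ} {α : Type u} {Q : Type v} (V : VASS d α Q) (c : Config d Q) : Prop :=
  ∃ f ∈ V.F, f.1 = c.1 ∧ f.2 ≤ c.2

/-- A run is accepting if it starts in an initial and ends in an accepting configuration. -/
def IsAcceptingRun {d : ℕ} {α : Type u} {Q : Type v} (V : VASS d α Q)
    (ρ : List (Transition d α Q)) : Prop :=
  ∃ c₀ ∈ V.I, ∃ c, V.RunFrom c₀ ρ c ∧ V.IsAcceptingConfig c

/-- The (coverability) language of a VASS. -/
def language {d : ℕ} {α : Type u} {Q : Type v} (V : VASS d α Q) : Language α :=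
  {w | ∃ ρ, V.IsAcceptingRun ρ ∧ word ρ = w}

/-- No transition reads `ε`. -/
def EpsilonFree {d : ℕ} {α : Type u} {Q : Type v} (V : VASS d α Q) : Prop :=
  ∀ t ∈ V.δ, t.label ≠ none

/-- `V` is `k`-ambiguous: every word of its language has at most `k` accepting runs. -/
def IsAmbiguous {d : ℕ} {α : Type u} {Q : Type v} (V : VASS d α Q) (k : ℕ) : Prop :=
  ∀ w ∈ V.language, {ρ | V.IsAcceptingRun ρ ∧ word ρ = w}.encard ≤ k

/-- The word `a^{x₁} b a^{x₂} b … b a^{xₙ₊₁}`. -/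
def blockWord {α : Type u} (a b : α) {n : ℕ} (x : Fin (n + 1) → ℕ) : List α :=
  List.intercalate [b] (List.ofFn fun i => List.replicate (x i) a)

/-- The set `im(L)` of block-length vectors of a language `L` all of whose words have exactly `n`
letters `b`. -/
def im {α : Type u} (a b : α) (n : ℕ) (L : Language α) : Set (Fin (n + 1) → ℕ) :=
  {x | blockWord a b x ∈ L}

end VASS

/-! Fix an initial configuration and order runs from it by embedding of their sequences of
configurations, each annotated with the transition fired there. By Dickson's and Higman's lemmas
this is a well-quasi-order, so the accepting runs have a finite basis (`exists_finite_basis`): every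
accepting run arises from some basis run `ρ` by inserting words between its transitions, with
counters raised (`Ext`).

Extensions of the same `ρ` amalgamate: their insertions may be concatenated position by position, in
any order (`Ext.zipWith_append`). As the number of letters `b` is fixed, insertions read only `a`
(`Ext.label_eq`), so the word read depends only on their lengths. If two extensions `S`, `S'` had
different products in the two orders, then `k` successive choices between these products would give
`2 ^ k > k` accepting runs on one word. Hence insertions commute (`Ext.zipWith_append_comm`), and
those at a given position are powers of one word (`exists_common_roots`).

So all extensions of `ρ` follow one flat scheme: the fixed transitions of `ρ`, separated by iterated
loops. Iterating a loop changes the counters affinely, so only its first and last iterations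
constrain them (`runFrom_listPow_iff`). The relation between counters and block lengths before and
after the scheme is therefore semilinear (`isSemilinearSet_follows`), and `im(L)` is a finite union
of projections of such relations. -/

namespace VASS

/-! ### Commuting words -/

section Words

variable {T : Type*}

/-- The `m`-fold repetition of a list. -/
def listPow (l : List T) (m : ℕ) : List T := (List.replicate m l).flatten

@[simp] lemma listPow_zero (l : List T) : listPow l 0 = [] := rfl

lemma listPow_succ (l : List T) (m : ℕ) : listPow l (m + 1) = l ++ listPow l m := by
  simp [listPow, List.replicate_succ]

@[simp] lemma length_listPow (l : List T) (m : ℕ) : (listPow l m).length = m * l.length := by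
  simp [listPow]

lemma subset_of_mem_listPow {l : List T} {m : ℕ} {t : T} (h : t ∈ listPow l m) : t ∈ l := by
  simp only [listPow, List.mem_flatten, List.mem_replicate] at h
  obtain ⟨s, ⟨-, rfl⟩, h⟩ := h
  exact h

lemma append_listPow_comm {x y : List T} (h : x ++ y = y ++ x) (m : ℕ) :
    listPow x m ++ y = y ++ listPow x m := by
  induction m with
  | zero => simp
  | succ m ih => rw [listPow_succ, List.append_assoc, ih, ← List.append_assoc, h, List.append_assoc]

/-- Both `y` and `listPow x m` are prefixes of `y ++ listPow x m`, because `y` can be moved past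
every copy of `x`. Thus words commuting with `x` are comparable as prefixes. -/
lemma prefix_listPow_of_comm {x y : List T} (hx : x ≠ []) (h : x ++ y = y ++ x) {m : ℕ}
    (hm : y.length ≤ m) : y <+: listPow x m := by
  refine List.prefix_of_prefix_length_le (l₃ := y ++ listPow x m) (List.prefix_append _ _) ?_ ?_
  · exact ⟨y, append_listPow_comm h m⟩
  · rw [length_listPow]
    exact hm.trans (Nat.le_mul_of_pos_right _ (List.length_pos_iff.mpr hx))

/-- The words commuting with a nonempty word are powers of a single word. -/
lemma exists_root (x : List T) (hx : x ≠ []) :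
    ∃ π : List T, π ⊆ x ∧ ∀ y, x ++ y = y ++ x → ∃ m, y = listPow π m := by
  classical
  have hex : ∃ k, ∃ π : List T, π ≠ [] ∧ x ++ π = π ++ x ∧ π.length = k := ⟨_, x, hx, rfl, rfl⟩
  obtain ⟨π, hπ, hc, hlen⟩ := Nat.find_spec hex
  refine ⟨π, fun t ht => subset_of_mem_listPow
    ((prefix_listPow_of_comm hx hc le_rfl).subset ht), fun y => ?_⟩
  induction hk : y.length using Nat.strong_induction_on generalizing y with
  | _ k ih =>
    intro hy
    by_cases hy0 : y = []
    · exact ⟨0, by simp [hy0]⟩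
    have hle : π.length ≤ y.length := by
      rw [hlen]; exact Nat.find_min' hex ⟨y, hy0, hy, rfl⟩
    -- `π` is a shortest nonempty word commuting with `x`, hence a prefix of `y`. The remainder `z`
    -- again commutes with `x` and is shorter.
    obtain ⟨z, rfl⟩ := List.prefix_of_prefix_length_le
      (prefix_listPow_of_comm hx hc hle) (prefix_listPow_of_comm hx hy le_rfl) hle
    have hz : x ++ z = z ++ x := by
      rw [← List.append_assoc, hc, List.append_assoc, List.append_assoc] at hy
      exact List.append_cancel_left hy
    obtain ⟨m, rfl⟩ := ih z.length
      (by have := List.length_pos_iff.mpr hπ; rw [List.length_append] at hk; omega) z rfl hz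
    exact ⟨m + 1, (listPow_succ _ _).symm⟩

/-- Pairwise commuting words are powers of a single word. -/
lemma exists_common_root (C : Set (List T)) (hC : ∀ x ∈ C, ∀ y ∈ C, x ++ y = y ++ x) :
    ∃ π : List T, (∀ t ∈ π, ∃ s ∈ C, t ∈ s) ∧ ∀ y ∈ C, ∃ m, y = listPow π m := by
  by_cases h : ∃ x ∈ C, x ≠ []
  · obtain ⟨x, hxC, hx⟩ := h
    obtain ⟨π, hsub, hπ⟩ := exists_root x hx
    exact ⟨π, fun t ht => ⟨x, hxC, hsub ht⟩, fun y hy => hπ y (hC x hxC y hy)⟩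
  · push Not at h
    exact ⟨[], by simp, fun y hy => ⟨0, h y hy⟩⟩

/-- Componentwise version of `exists_common_root`. -/
lemma exists_common_roots (N : ℕ) (C : Set (List (List T))) (hlen : ∀ S ∈ C, S.length = N)
    (hC : ∀ S ∈ C, ∀ S' ∈ C, List.zipWith (· ++ ·) S S' = List.zipWith (· ++ ·) S' S) :
    ∃ R : List (List T), (∀ π ∈ R, ∀ t ∈ π, ∃ S ∈ C, ∃ s ∈ S, t ∈ s) ∧
      ∀ S ∈ C, List.Forall₂ (fun π s => ∃ m, s = listPow π m) R S := by
  induction N generalizing C with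
  | zero =>
    refine ⟨[], by simp, fun S hS => ?_⟩
    rw [List.length_eq_zero_iff.mp (hlen S hS)]
    exact .nil
  | succ N ih =>
    obtain ⟨π, hπ, hπC⟩ := exists_common_root {s | ∃ S, s :: S ∈ C} (by
      rintro x ⟨S, hS⟩ y ⟨S', hS'⟩
      have := hC _ hS _ hS'
      simp only [List.zipWith_cons_cons, List.cons.injEq] at this
      exact this.1)
    obtain ⟨R, hR, hRC⟩ := ih {S | ∃ s, s :: S ∈ C}
      (by
        rintro S ⟨s, hS⟩
        simpa using hlen _ hS)
      (by
        rintro x ⟨S, hS⟩ y ⟨S', hS'⟩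
        have := hC _ hS _ hS'
        simp only [List.zipWith_cons_cons, List.cons.injEq] at this
        exact this.2)
    refine ⟨π :: R, ?_, ?_⟩
    · intro ρ hρ t ht
      rcases List.mem_cons.mp hρ with rfl | hρ
      · obtain ⟨s, ⟨S, hS⟩, hts⟩ := hπ t ht
        exact ⟨_, hS, s, by simp, hts⟩
      · obtain ⟨S, ⟨s, hS⟩, s', hs', hts⟩ := hR ρ hρ t ht
        exact ⟨_, hS, s', by simp [hs'], hts⟩
    · intro S hS
      match S, hlen S hS with
      | s :: S, _ => exact .cons (hπC s ⟨S, hS⟩) (hRC S ⟨s, hS⟩)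

/-- The lengths of the left factors determine where each concatenation has to be cut. -/
lemma zipWith_append_inj {A A' B B' : List (List T)} (hA : A.map List.length = A'.map List.length)
    (hAB : A.length = B.length) (hAB' : A'.length = B'.length)
    (h : List.zipWith (· ++ ·) A B = List.zipWith (· ++ ·) A' B') : A = A' ∧ B = B' := by
  induction A generalizing A' B B' with
  | nil =>
    obtain rfl : A' = [] := by simpa using hA.symm
    obtain rfl : B = [] := by simpa using hAB.symm
    obtain rfl : B' = [] := by simpa using hAB'.symm
    simp
  | cons s A ih =>
    match A', B, B', hAB, hAB' with
    | [], _, _, _, _ => simp at hA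
    | s' :: A', t :: B, t' :: B', hAB, hAB' =>
      simp only [List.map_cons, List.cons.injEq] at hA
      simp only [List.zipWith_cons_cons, List.cons.injEq] at h
      obtain ⟨rfl, rfl⟩ := List.append_inj h.1 hA.1
      obtain ⟨rfl, rfl⟩ := ih hA.2 (by simpa using hAB) (by simpa using hAB') h.2
      simp

/-- The word `s₀ t₁ s₁ t₂ … tₗ sₗ` obtained by inserting the words `s₀, …, sₗ` into `t₁ … tₗ`. -/
def weave : List T → List (List T) → List T
  | _, [] => []
  | [], s :: _ => s
  | t :: ρ, s :: S => s ++ t :: weave ρ S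

lemma weave_inj {ρ : List T} {S S' : List (List T)} (hS : S.length = ρ.length + 1)
    (h : S.map List.length = S'.map List.length) (hw : weave ρ S = weave ρ S') : S = S' := by
  induction ρ generalizing S S' with
  | nil =>
    obtain ⟨s, rfl⟩ := List.length_eq_one_iff.mp hS
    have hS' : S'.length = 1 := by simpa using congrArg List.length h.symm
    obtain ⟨s', rfl⟩ := List.length_eq_one_iff.mp hS'
    simpa [weave] using hw
  | cons t ρ ih =>
    match S, S', hS, h with
    | s :: S, s' :: S', hS, h =>
      simp only [List.map_cons, List.cons.injEq] at h
      simp only [weave] at hw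
      obtain ⟨rfl, h2⟩ := List.append_inj hw h.1
      rw [ih (by simpa using hS) h.2 (List.cons.inj h2).2]

lemma mem_weave {ρ : List T} {S : List (List T)} (hS : S.length = ρ.length + 1) {s : List T}
    (hs : s ∈ S) {t : T} (ht : t ∈ s) : t ∈ weave ρ S := by
  induction ρ generalizing S with
  | nil =>
    match S, hS with
    | [s'], _ => simp_all [weave]
  | cons r ρ ih =>
    match S, hS with
    | s' :: S, hS =>
      simp only [weave, List.mem_append, List.mem_cons]
      rcases List.mem_cons.mp hs with rfl | hs
      · exact .inl ht
      · exact .inr (.inr (ih (by simpa using hS) hs))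

end Words

end VASS

namespace VASS

/-! ### Runs and their extensions -/

section Runs

variable {d : ℕ} {α : Type u} {Q : Type v} {V : VASS d α Q}

lemma Transition.Fires.unique {t : Transition d α Q} {c c₁ c₂ : Config d Q} (h₁ : t.Fires c c₁)
    (h₂ : t.Fires c c₂) : c₁ = c₂ := by
  refine Prod.ext (h₁.2.1.trans h₂.2.1.symm) (funext fun i => ?_)
  have := h₁.2.2 i
  have := h₂.2.2 i
  omega

lemma Transition.Fires.add {t : Transition d α Q} {c c' : Config d Q} (h : t.Fires c c')
    (v : Fin d → ℕ) : t.Fires (c.1, c.2 + v) (c'.1, c'.2 + v) := by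
  refine ⟨h.1, h.2.1, fun i => ?_⟩
  have := h.2.2 i
  simp only [Pi.add_apply]
  push_cast
  omega

lemma RunFrom.append {c c' c'' : Config d Q} {ρ ρ' : List (Transition d α Q)}
    (h : V.RunFrom c ρ c') (h' : V.RunFrom c' ρ' c'') : V.RunFrom c (ρ ++ ρ') c'' := by
  induction h with
  | nil => exact h'
  | cons ht hf _ ih => exact .cons ht hf (ih h')

lemma RunFrom.add {c c' : Config d Q} {ρ : List (Transition d α Q)} (h : V.RunFrom c ρ c')
    (v : Fin d → ℕ) : V.RunFrom (c.1, c.2 + v) ρ (c'.1, c'.2 + v) := by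
  induction h with
  | nil => exact .nil _
  | cons ht hf _ ih => exact .cons ht (hf.add v) ih

lemma RunFrom.add_pair {q q' : Q} {u u' : Fin d → ℕ} {ρ : List (Transition d α Q)}
    (h : V.RunFrom (q, u) ρ (q', u')) (v : Fin d → ℕ) : V.RunFrom (q, u + v) ρ (q', u' + v) :=
  h.add v

lemma RunFrom.mem {c c' : Config d Q} {ρ : List (Transition d α Q)} (h : V.RunFrom c ρ c') :
    ∀ t ∈ ρ, t ∈ V.δ := by
  induction h with
  | nil => simp
  | cons ht _ _ ih => simpa using ⟨ht, ih⟩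

@[simp] lemma word_nil : word ([] : List (Transition d α Q)) = [] := rfl

@[simp] lemma word_append (ρ ρ' : List (Transition d α Q)) :
    word (ρ ++ ρ') = word ρ ++ word ρ' := by
  simp [word]

lemma word_cons (t : Transition d α Q) (ρ : List (Transition d α Q)) :
    word (t :: ρ) = word [t] ++ word ρ := by
  rw [← word_append]; rfl

lemma word_eq_replicate {a : α} {ρ : List (Transition d α Q)} (h : ∀ t ∈ ρ, t.label = some a) :
    word ρ = List.replicate ρ.length a := by
  induction ρ with
  | nil => rfl
  | cons t ρ ih =>
    rw [word_cons, ih fun t ht => h t (by simp [ht])]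
    simp [word, h t (by simp), List.replicate_succ]

/-- `V.Ext c ρ e v S w`: the run `ρ` from `c` to `e` can be extended by inserting the words `S`,
starting from `c` raised by `v` and ending in `e` raised by `w`. -/
inductive Ext (V : VASS d α Q) : Config d Q → List (Transition d α Q) → Config d Q →
    (Fin d → ℕ) → List (List (Transition d α Q)) → (Fin d → ℕ) → Prop
  | nil {c : Config d Q} {v w : Fin d → ℕ} {s : List (Transition d α Q)}
      (hs : V.RunFrom (c.1, c.2 + v) s (c.1, c.2 + w)) : Ext V c [] c v [s] w
  | cons {c c' e : Config d Q} {t : Transition d α Q} {ρ s : List (Transition d α Q)}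
      {S : List (List (Transition d α Q))} {v v' w : Fin d → ℕ}
      (hs : V.RunFrom (c.1, c.2 + v) s (c.1, c.2 + v')) (ht : t ∈ V.δ) (hf : t.Fires c c')
      (h : Ext V c' ρ e v' S w) : Ext V c (t :: ρ) e v (s :: S) w

variable {c e : Config d Q} {ρ : List (Transition d α Q)} {v w : Fin d → ℕ}
  {S : List (List (Transition d α Q))}

lemma Ext.length (h : V.Ext c ρ e v S w) : S.length = ρ.length + 1 := by
  induction h with
  | nil => rfl
  | cons _ _ _ _ ih => simp [ih]

lemma Ext.runFrom (h : V.Ext c ρ e v S w) : V.RunFrom c ρ e := by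
  induction h with
  | nil => exact .nil _
  | cons _ ht hf _ ih => exact .cons ht hf ih

lemma Ext.runFrom_weave (h : V.Ext c ρ e v S w) :
    V.RunFrom (c.1, c.2 + v) (weave ρ S) (e.1, e.2 + w) := by
  induction h with
  | nil hs => exact hs
  | cons hs ht hf _ ih => exact hs.append (.cons ht (hf.add _) ih)

lemma RunFrom.ext_replicate (h : V.RunFrom c ρ e) (v : Fin d → ℕ) :
    V.Ext c ρ e v (List.replicate (ρ.length + 1) []) v := by
  induction h with
  | nil => exact .nil (.nil _)
  | cons ht hf _ ih => exact .cons (.nil _) ht hf ih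

/-- Amalgamation of extensions. -/
lemma Ext.zipWith_append {v' w' : Fin d → ℕ} {S' : List (List (Transition d α Q))}
    (h : V.Ext c ρ e v S w) (h' : V.Ext c ρ e v' S' w') :
    V.Ext c ρ e (v + v') (List.zipWith (· ++ ·) S S') (w + w') := by
  -- Monotonicity: `s` runs while the surplus `v'` lies idle, then `s'` runs above the surplus `v₁`
  -- left by `s`.
  have key : ∀ {q : Q} {u v v₁ v' v₁' : Fin d → ℕ} {s s' : List (Transition d α Q)},
      V.RunFrom (q, u + v) s (q, u + v₁) → V.RunFrom (q, u + v') s' (q, u + v₁') →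
      V.RunFrom (q, u + (v + v')) (s ++ s') (q, u + (v₁ + v₁')) := by
    intro q u v v₁ v' v₁' s s' hs hs'
    have h1 := hs.add_pair v'
    have h2 := hs'.add_pair v₁
    rw [add_assoc, add_assoc] at h1 h2
    rw [add_comm v' v₁, add_comm v₁' v₁] at h2
    exact h1.append h2
  induction h generalizing v' S' w' with
  | nil hs =>
    cases h' with
    | nil hs' => exact .nil (key hs hs')
  | cons hs ht hf _ ih =>
    cases h' with
    | cons hs' _ hf' h' =>
      obtain rfl := hf.unique hf'
      exact .cons (key hs hs') ht hf (ih h')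

lemma Ext.prepend {v₀ : Fin d → ℕ} {s : List (Transition d α Q)}
    (hs : V.RunFrom (c.1, c.2 + v₀) s (c.1, c.2 + v)) (h : V.Ext c ρ e v ([] :: S) w) :
    V.Ext c ρ e v₀ (s :: S) w := by
  cases h with
  | nil h' =>
    refine .nil ?_
    simpa using hs.append h'
  | cons h' ht hf h =>
    refine .cons ?_ ht hf h
    simpa using hs.append h'

lemma weave_nil_cons (ρ : List (Transition d α Q)) (s : List (Transition d α Q))
    (S : List (List (Transition d α Q))) : weave ρ (s :: S) = s ++ weave ρ ([] :: S) := by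
  cases ρ <;> simp [weave]

/-! ### The well-quasi-order on runs -/

/-- The configuration reached by firing `t` (meaningful if `t` can be fired). -/
def next (c : Config d Q) (t : Transition d α Q) : Config d Q :=
  (t.tgt, fun i => (c.2 i + t.eff i).toNat)

lemma Transition.Fires.eq_next {t : Transition d α Q} {c c' : Config d Q} (h : t.Fires c c') :
    c' = next c t := by
  refine Prod.ext h.2.1 (funext fun i => ?_)
  have := h.2.2 i
  simp only [next]
  omega

/-- The list of configurations of a run, together with the transitions fired in them. -/
def annotate : Config d Q → List (Transition d α Q) → List (Config d Q × Option (Transition d α Q))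
  | c, [] => [(c, none)]
  | c, t :: ρ => (c, some t) :: annotate (next c t) ρ

/-- The order on annotated configurations. -/
def AnnLE (x y : Config d Q × Option (Transition d α Q)) : Prop :=
  (x.1.1 = y.1.1 ∧ x.2 = y.2) ∧ x.1.2 ≤ y.1.2

instance : IsPreorder (Config d Q × Option (Transition d α Q)) AnnLE where
  refl _ := ⟨⟨rfl, rfl⟩, le_rfl⟩
  trans _ _ _ h h' := ⟨⟨h.1.1.trans h'.1.1, h.1.2.trans h'.1.2⟩, h.2.trans h'.2⟩

/-- The stretches of `ρ'` between matched positions are the insertions; they return to the same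
state because matched positions agree in state. The end marker `none` only matches the end of `ρ'`,
so nothing is left over. The stretch `s` before the first match is kept apart, since `d'` need not
lie above `c`. -/
lemma exists_ext_of_sublistForall₂ {d' e' : Config d Q} {ρ' : List (Transition d α Q)}
    (h : V.RunFrom c ρ e) (h' : V.RunFrom d' ρ' e')
    (hsub : List.SublistForall₂ AnnLE (annotate c ρ) (annotate d' ρ')) :
    ∃ s S v w, V.RunFrom d' s (c.1, c.2 + v) ∧ V.Ext c ρ e v ([] :: S) w ∧
      ρ' = s ++ weave ρ ([] :: S) ∧ e' = (e.1, e.2 + w) := by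
  induction h' generalizing c ρ with
  | nil d' =>
    cases h with
    | nil =>
      simp only [annotate] at hsub
      cases hsub with
      | cons hle _ =>
        obtain ⟨⟨h1, -⟩, h2⟩ := hle
        have hd : d' = (e.1, e.2 + (d'.2 - e.2)) :=
          Prod.ext h1.symm (add_tsub_cancel_of_le h2).symm
        exact ⟨[], [], d'.2 - e.2, d'.2 - e.2, by rw [← hd]; exact .nil _, .nil (.nil _),
          rfl, hd⟩
      | cons_right h => cases h
    | cons _ _ _ =>
      simp only [annotate] at hsub
      cases hsub with
      | cons hle _ => simp [AnnLE] at hle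
      | cons_right h => cases h
  | @cons d' d₁ e' t' ρ' ht' hf' hρ' ih =>
    simp only [annotate] at hsub
    rw [← hf'.eq_next] at hsub
    -- If the first position of the larger run is unmatched, its transition joins the initial
    -- stretch `s`.
    have skip : List.SublistForall₂ AnnLE (annotate c ρ) (annotate d₁ ρ') →
        ∃ s S v w, V.RunFrom d' s (c.1, c.2 + v) ∧ V.Ext c ρ e v ([] :: S) w ∧
          t' :: ρ' = s ++ weave ρ ([] :: S) ∧ e' = (e.1, e.2 + w) := by
      intro hsub
      obtain ⟨s, S, v, w, hs, hS, hw, he⟩ := ih h hsub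
      exact ⟨t' :: s, S, v, w, .cons ht' hf' hs, hS, by rw [hw]; rfl, he⟩
    cases h with
    | nil =>
      simp only [annotate] at hsub skip
      cases hsub with
      | cons hle _ => simp [AnnLE] at hle
      | cons_right h => exact skip h
    | @cons _ c₁ _ t ρ ht hf hρ =>
      simp only [annotate] at hsub skip
      rw [← hf.eq_next] at hsub skip
      cases hsub with
      | cons hle hsub =>
        obtain ⟨⟨h1, h3⟩, h2⟩ := hle
        obtain rfl : t = t' := Option.some.inj h3
        have hd : d' = (c.1, c.2 + (d'.2 - c.2)) :=
          Prod.ext h1.symm (add_tsub_cancel_of_le h2).symm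
        have hd₁ : d₁ = (c₁.1, c₁.2 + (d'.2 - c.2)) := by
          refine hf'.unique ?_
          have := hf.add (d'.2 - c.2)
          rwa [← hd] at this
        obtain ⟨s, S, v, w, hs, hS, rfl, he⟩ := ih hρ hsub
        refine ⟨[], s :: S, d'.2 - c.2, w, by rw [← hd]; exact .nil _,
          .cons (.nil _) ht hf (hS.prepend (hd₁ ▸ hs)), ?_, he⟩
        simp only [weave, List.nil_append]
        rw [weave_nil_cons ρ s S]
      | cons_right h => exact skip h

lemma mem_annotate (hρ : ∀ t ∈ ρ, t ∈ V.δ) :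
    ∀ x ∈ annotate c ρ, x ∈ {x : Config d Q × Option (Transition d α Q) |
      ∀ t ∈ x.2, t ∈ V.δ} := by
  induction ρ generalizing c with
  | nil => simp [annotate]
  | cons t ρ ih =>
    simp only [annotate, List.mem_cons]
    rintro x (rfl | hx)
    · simpa using hρ t (by simp)
    · exact ih (fun t ht => hρ t (by simp [ht])) x hx

/-- State and transition range over finite sets, and counter vectors are well-quasi-ordered by
Dickson's lemma. -/
lemma partiallyWellOrderedOn_annLE [Finite Q] (V : VASS d α Q) :
    {x : Config d Q × Option (Transition d α Q) | ∀ t ∈ x.2, t ∈ V.δ}.PartiallyWellOrderedOn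
      AnnLE := by
  classical
  intro f
  let g : ℕ → (Q × Option V.δ) × (Fin d → ℕ) := fun n =>
    (((f n).1.1.1, (f n).1.2.pmap (fun t ht => ⟨t, ht⟩) (f n).2), (f n).1.1.2)
  have hw : WellQuasiOrdered (fun x y : (Q × Option V.δ) × (Fin d → ℕ) =>
      x.1 = y.1 ∧ x.2 ≤ y.2) :=
    WellQuasiOrdered.prod (Finite.wellQuasiOrdered (· = ·)) wellQuasiOrdered_le
  obtain ⟨m, n, hmn, h1, h2⟩ := hw g
  refine ⟨m, n, hmn, ⟨(Prod.ext_iff.mp h1).1, ?_⟩, h2⟩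
  have := congrArg (Option.map Subtype.val) (Prod.ext_iff.mp h1).2
  simpa [g, Option.map_pmap] using this

/-- The accepting runs from a fixed configuration have a finite basis. -/
lemma exists_finite_basis [Finite Q] (V : VASS d α Q) (c₀ : Config d Q) :
    ∃ B : Finset (List (Transition d α Q)),
      (∀ ρ ∈ B, ∃ e, V.RunFrom c₀ ρ e ∧ V.IsAcceptingConfig e) ∧
      ∀ ρ' e', V.RunFrom c₀ ρ' e' → V.IsAcceptingConfig e' → ∃ ρ ∈ B, ∀ e, V.RunFrom c₀ ρ e →
        ∃ S w, V.Ext c₀ ρ e 0 S w ∧ ρ' = weave ρ S ∧ e' = (e.1, e.2 + w) := by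
  suffices h : ∃ B : Finset (List (Transition d α Q)),
      (∀ ρ ∈ B, ∃ e, V.RunFrom c₀ ρ e ∧ V.IsAcceptingConfig e) ∧
      ∀ ρ', (∃ e, V.RunFrom c₀ ρ' e ∧ V.IsAcceptingConfig e) →
        ∃ ρ ∈ B, List.SublistForall₂ AnnLE (annotate c₀ ρ) (annotate c₀ ρ') by
    obtain ⟨B, hB, h⟩ := h
    refine ⟨B, hB, fun ρ' e' hρ' he' => ?_⟩
    obtain ⟨ρ, hρ, hsub⟩ := h ρ' ⟨e', hρ', he'⟩
    refine ⟨ρ, hρ, fun e he => ?_⟩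
    obtain ⟨s, S, v, w, hs, hS, rfl, he⟩ := exists_ext_of_sublistForall₂ he hρ' hsub
    exact ⟨s :: S, w, hS.prepend (by simpa using hs), (weave_nil_cons _ _ _).symm, he⟩
  -- Without a finite basis, accepting runs could be chosen one by one, each above none of its
  -- predecessors: a bad sequence.
  by_contra! hcon
  obtain ⟨f, hf, hr⟩ := exists_seq_of_forall_finset_exists
    (fun ρ => ∃ e, V.RunFrom c₀ ρ e ∧ V.IsAcceptingConfig e)
    (fun ρ ρ' => ¬ List.SublistForall₂ AnnLE (annotate c₀ ρ) (annotate c₀ ρ')) hcon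
  have hpwo := (partiallyWellOrderedOn_annLE V).partiallyWellOrderedOn_sublistForall₂
  obtain ⟨m, n, hmn, h⟩ := hpwo fun n => ⟨annotate c₀ (f n), mem_annotate (by
    obtain ⟨e, he, -⟩ := hf n
    exact he.mem)⟩
  exact hr m n hmn h

end Runs

end VASS

namespace VASS

/-! ### Bounded ambiguity forces insertions to commute -/

section Ambiguity

variable {d : ℕ} {α : Type u} {Q : Type v} {V : VASS d α Q} {c e : Config d Q}
  {ρ : List (Transition d α Q)} {v w : Fin d → ℕ} {S S' : List (List (Transition d α Q))}

lemma IsAcceptingConfig.add (h : V.IsAcceptingConfig e) (w : Fin d → ℕ) :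
    V.IsAcceptingConfig (e.1, e.2 + w) := by
  obtain ⟨f, hf, h1, h2⟩ := h
  exact ⟨f, hf, h1, h2.trans le_self_add⟩

lemma Ext.isAcceptingRun_weave (hc : c ∈ V.I) (he : V.IsAcceptingConfig e)
    (h : V.Ext c ρ e 0 S w) : V.IsAcceptingRun (weave ρ S) :=
  ⟨c, hc, _, by simpa using h.runFrom_weave, he.add w⟩

lemma count_word_weave [DecidableEq α] (b : α) (hS : S.length = ρ.length + 1) :
    (word (weave ρ S)).count b = (word ρ).count b + (S.map fun s => (word s).count b).sum := by
  induction ρ generalizing S with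
  | nil =>
    obtain ⟨s, rfl⟩ := List.length_eq_one_iff.mp hS
    simp [weave]
  | cons t ρ ih =>
    match S, hS with
    | s :: S, hS =>
      simp only [weave, word_append, List.count_append, List.map_cons, List.sum_cons]
      rw [word_cons t (weave ρ S), word_cons t ρ, List.count_append, List.count_append,
        ih (by simpa using hS)]
      omega

/-- If all accepted words have the same number of `b` and otherwise only contain `a`, then only
words over `a` can be inserted into an accepting run. -/
lemma Ext.label_eq [DecidableEq α] {a b : α} {n : ℕ} (hε : V.EpsilonFree)
    (hab : ∀ w ∈ V.language, ∀ x ∈ w, x = a ∨ x = b) (hn : ∀ w ∈ V.language, w.count b = n)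
    (hc : c ∈ V.I) (he : V.IsAcceptingConfig e) (h : V.Ext c ρ e 0 S w) :
    ∀ s ∈ S, ∀ t ∈ s, t.label = some a := by
  intro s hs t ht
  have hmem : word (weave ρ S) ∈ V.language := ⟨_, h.isAcceptingRun_weave hc he, rfl⟩
  have hcount := count_word_weave b h.length (ρ := ρ)
  rw [hn _ hmem, hn _ ⟨ρ, ⟨c, hc, e, h.runFrom, he⟩, rfl⟩] at hcount
  have hsum : (S.map fun s => (word s).count b).sum = 0 := by omega
  have hs0 : (word s).count b = 0 :=
    List.sum_eq_zero_iff.mp hsum _ (List.mem_map.mpr ⟨s, hs, rfl⟩)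
  have htw : t ∈ weave ρ S := mem_weave h.length hs ht
  obtain ⟨x, hx⟩ := Option.ne_none_iff_exists'.mp (hε t (h.runFrom_weave.mem t htw))
  rcases hab _ hmem x (List.mem_filterMap.mpr ⟨t, htw, hx⟩) with rfl | rfl
  · exact hx
  · exact absurd (List.mem_filterMap.mpr ⟨t, ht, hx⟩) (List.count_eq_zero.mp hs0)

/-- Words over the single letter `a` are determined by their lengths. -/
lemma word_weave_eq {a : α} (hS : ∀ s ∈ S, ∀ t ∈ s, t.label = some a)
    (hS' : ∀ s ∈ S', ∀ t ∈ s, t.label = some a) (hlen : S.length = ρ.length + 1)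
    (h : S.map List.length = S'.map List.length) : word (weave ρ S) = word (weave ρ S') := by
  induction ρ generalizing S S' with
  | nil =>
    have hlen' : S'.length = 1 := by simpa [hlen] using (congrArg List.length h).symm
    obtain ⟨s, rfl⟩ := List.length_eq_one_iff.mp hlen
    obtain ⟨s', rfl⟩ := List.length_eq_one_iff.mp hlen'
    simp only [List.map_cons, List.cons.injEq] at h
    simp only [weave]
    rw [word_eq_replicate (hS s (by simp)), word_eq_replicate (hS' s' (by simp)), h.1]
  | cons t ρ ih =>
    match S, S', hlen, h with
    | s :: S, s' :: S', hlen, h =>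
      simp only [List.map_cons, List.cons.injEq] at h
      simp only [weave, word_append]
      rw [word_cons t (weave ρ S), word_cons t (weave ρ S'),
        word_eq_replicate (hS s (by simp)), word_eq_replicate (hS' s' (by simp)), h.1,
        ih (fun s hs => hS s (by simp [hs])) (fun s hs => hS' s (by simp [hs]))
          (by simpa using hlen) h.2]

/-- The insertion obtained from a sequence of choices between `Z` and `Z'`. -/
def amalgam {T : Type*} (N : ℕ) (Z Z' : List (List T)) : List Bool → List (List T)
  | [] => List.replicate N []
  | x :: β => List.zipWith (· ++ ·) (bif x then Z else Z') (amalgam N Z Z' β)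

lemma length_amalgam {T : Type*} {N : ℕ} {Z Z' : List (List T)} (hZ : Z.length = N)
    (hZ' : Z'.length = N) (β : List Bool) : (amalgam N Z Z' β).length = N := by
  induction β with
  | nil => simp [amalgam]
  | cons x β ih => cases x <;> simp [amalgam, ih, hZ, hZ']

lemma map_length_zipWith_append {T : Type*} (A B : List (List T)) :
    (List.zipWith (· ++ ·) A B).map List.length =
      List.zipWith (· + ·) (A.map List.length) (B.map List.length) := by
  induction A generalizing B with
  | nil => simp
  | cons s A ih => cases B <;> simp [ih]

lemma map_length_amalgam {T : Type*} {N : ℕ} {Z Z' : List (List T)}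
    (h : Z.map List.length = Z'.map List.length) {β β' : List Bool}
    (hβ : β.length = β'.length) :
    (amalgam N Z Z' β).map List.length = (amalgam N Z Z' β').map List.length := by
  induction β generalizing β' with
  | nil =>
    obtain rfl : β' = [] := by simpa using hβ.symm
    rfl
  | cons x β ih =>
    match β', hβ with
    | y :: β', hβ =>
      simp only [amalgam, map_length_zipWith_append]
      rw [ih (by simpa using hβ)]
      cases x <;> cases y <;> simp [h]

/-- Since `Z` and `Z'` have the same componentwise lengths, the first factor can be cut off
whichever choice was made, and `Z ≠ Z'` then reveals the choice. -/
lemma amalgam_inj {T : Type*} {N : ℕ} {Z Z' : List (List T)} (hZ : Z.length = N)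
    (h : Z.map List.length = Z'.map List.length) (hne : Z ≠ Z') {β β' : List Bool}
    (hβ : β.length = β'.length) (heq : amalgam N Z Z' β = amalgam N Z Z' β') : β = β' := by
  have hZ' : Z'.length = N := by simpa [hZ] using (congrArg List.length h).symm
  induction β generalizing β' with
  | nil =>
    obtain rfl : β' = [] := by simpa using hβ.symm
    rfl
  | cons x β ih =>
    match β', hβ with
    | y :: β', hβ =>
      obtain ⟨h1, h2⟩ := zipWith_append_inj (by cases x <;> cases y <;> simp [h])
        (by cases x <;> simp [length_amalgam, hZ, hZ'])
        (by cases y <;> simp [length_amalgam, hZ, hZ']) heq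
      rw [ih (by simpa using hβ) h2]
      cases x <;> cases y <;> simp_all

lemma Ext.amalgam {Z Z' : List (List (Transition d α Q))} {w' : Fin d → ℕ}
    (h : V.Ext c ρ e 0 Z w) (h' : V.Ext c ρ e 0 Z' w') (β : List Bool) :
    ∃ w, V.Ext c ρ e 0 (amalgam (ρ.length + 1) Z Z' β) w := by
  induction β with
  | nil => exact ⟨0, h.runFrom.ext_replicate 0⟩
  | cons x β ih =>
    obtain ⟨w₁, h₁⟩ := ih
    cases x
    · exact ⟨_, by simpa [VASS.amalgam] using h'.zipWith_append h₁⟩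
    · exact ⟨_, by simpa [VASS.amalgam] using h.zipWith_append h₁⟩

/-- In a boundedly ambiguous VASS, insertions into an accepting run commute. -/
lemma Ext.zipWith_append_comm [DecidableEq α] {a b : α} {n k : ℕ} {w' : Fin d → ℕ}
    (hk : V.IsAmbiguous k) (hε : V.EpsilonFree)
    (hab : ∀ w ∈ V.language, ∀ x ∈ w, x = a ∨ x = b) (hn : ∀ w ∈ V.language, w.count b = n)
    (hc : c ∈ V.I) (he : V.IsAcceptingConfig e)
    (h : V.Ext c ρ e 0 S w) (h' : V.Ext c ρ e 0 S' w') :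
    List.zipWith (· ++ ·) S S' = List.zipWith (· ++ ·) S' S := by
  by_contra hne
  set Z := List.zipWith (· ++ ·) S S' with hZdef
  set Z' := List.zipWith (· ++ ·) S' S with hZ'def
  have hZ : V.Ext c ρ e 0 Z (w + w') := by simpa using h.zipWith_append h'
  have hZ' : V.Ext c ρ e 0 Z' (w' + w) := by simpa using h'.zipWith_append h
  have hlen : Z.map List.length = Z'.map List.length := by
    rw [hZdef, hZ'def, map_length_zipWith_append, map_length_zipWith_append,
      List.zipWith_comm_of_comm (fun x y => add_comm x y)]
  -- All `2 ^ k` choice sequences give distinct accepting runs reading the same word, which is more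
  -- than `k` allows.
  let G : (Fin k → Bool) → List (Transition d α Q) := fun β =>
    weave ρ (VASS.amalgam (ρ.length + 1) Z Z' (List.ofFn β))
  have hlabel : ∀ β : List Bool, ∀ s ∈ VASS.amalgam (ρ.length + 1) Z Z' β, ∀ t ∈ s,
      t.label = some a := fun β => by
    obtain ⟨w₁, h₁⟩ := hZ.amalgam hZ' β
    exact h₁.label_eq hε hab hn hc he
  have hacc : ∀ β, V.IsAcceptingRun (G β) := fun β => by
    obtain ⟨w₁, h₁⟩ := hZ.amalgam hZ' (List.ofFn β)
    exact h₁.isAcceptingRun_weave hc he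
  have hlenA : ∀ β : List Bool, (VASS.amalgam (ρ.length + 1) Z Z' β).length = ρ.length + 1 :=
    length_amalgam hZ.length hZ'.length
  have hinj : Function.Injective G := by
    intro β β' hβ
    have h1 := weave_inj (hlenA _) (map_length_amalgam hlen (by simp)) hβ
    exact List.ofFn_injective (amalgam_inj hZ.length hlen hne (by simp) h1)
  have hword : ∀ β, word (G β) = word (G fun _ => true) := fun β =>
    word_weave_eq (hlabel _) (hlabel _) (hlenA _) (map_length_amalgam hlen (by simp))
  have hbound := hk (word (G fun _ => true)) ⟨_, hacc _, rfl⟩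
  have hsub : Set.range G ⊆ {ρ | V.IsAcceptingRun ρ ∧ word ρ = word (G fun _ => true)} := by
    rintro _ ⟨β, rfl⟩
    exact ⟨hacc β, hword β⟩
  have hcard : (Set.range G).encard = (2 ^ k : ℕ) := by
    rw [← Set.image_univ, hinj.encard_image, Set.encard_univ]
    simp
  have := (Set.encard_le_encard hsub).trans hbound
  rw [hcard] at this
  exact absurd (Nat.cast_le.mp this) (not_le.mpr k.lt_two_pow_self)

end Ambiguity

end VASS

/-! ### Semilinear relations -/

section Semilinear

variable {M N : Type*} [AddCommMonoid M] [AddCommMonoid N]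

/-- Semilinear relations are closed under composition. -/
lemma IsSemilinearSet.comp [AddMonoid.FG M] [IsCancelAdd M] {R S : Set (M × M)}
    (hR : IsSemilinearSet R) (hS : IsSemilinearSet S) :
    IsSemilinearSet {z : M × M | ∃ y, (z.1, y) ∈ R ∧ (y, z.2) ∈ S} := by
  let f₁ : M × M × M →+ M × M :=
    (AddMonoidHom.fst M (M × M)).prod ((AddMonoidHom.fst M M).comp (AddMonoidHom.snd M (M × M)))
  let f₂ : M × M × M →+ M × M := AddMonoidHom.snd M (M × M)
  let f₃ : M × M × M →+ M × M :=
    (AddMonoidHom.fst M (M × M)).prod ((AddMonoidHom.snd M M).comp (AddMonoidHom.snd M (M × M)))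
  convert! ((hR.preimage f₁).inter (hS.preimage f₂)).image f₃ using 1
  ext z
  constructor
  · rintro ⟨y, h1, h2⟩
    exact ⟨(z.1, y, z.2), ⟨h1, h2⟩, rfl⟩
  · rintro ⟨⟨x, y, x'⟩, ⟨h1, h2⟩, rfl⟩
    exact ⟨y, h1, h2⟩

/-- Add a slack vector to turn the inequality into an equation, then project it away. -/
lemma isSemilinearSet_setOf_le [AddMonoid.FG M] {d : ℕ} (a b : Fin d → ℕ)
    (f g : M →+ (Fin d → ℕ)) : IsSemilinearSet {x | a + f x ≤ b + g x} := by
  convert! (isSemilinearSet_setOfPred_eq a b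
    ((f.comp (AddMonoidHom.fst M (Fin d → ℕ))) + AddMonoidHom.snd M (Fin d → ℕ))
    (g.comp (AddMonoidHom.fst M (Fin d → ℕ)))).image (AddMonoidHom.fst M (Fin d → ℕ)) using 1
  ext x
  constructor
  · intro h
    obtain ⟨y, hy⟩ := exists_add_of_le (Set.mem_ofPred_eq ▸ h)
    exact ⟨(x, y), by simpa [add_assoc] using hy.symm, rfl⟩
  · rintro ⟨⟨x, y⟩, h, rfl⟩
    have h' : a + (f x + y) = b + g x := h
    show a + f x ≤ b + g x
    rw [← h', ← add_assoc]
    exact le_self_add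

end Semilinear

namespace VASS

/-! ### Counting block lengths along a word -/

section Track

variable {α : Type u} [DecidableEq α] {n : ℕ}

/-- The effect of reading a letter on the pair consisting of the number of letters `b` read so far
and the vector of block lengths. -/
def trackStep (b : α) (s : ℕ × (Fin (n + 1) → ℕ)) (x : α) : ℕ × (Fin (n + 1) → ℕ) :=
  if x = b then (s.1 + 1, s.2) else (s.1, s.2 + fun i => if i.val = s.1 then 1 else 0)

/-- The effect of reading a word on the number of letters `b` and the block lengths. -/
def track (b : α) (s : ℕ × (Fin (n + 1) → ℕ)) (w : List α) : ℕ × (Fin (n + 1) → ℕ) :=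
  w.foldl (trackStep b) s

lemma track_append (b : α) (s : ℕ × (Fin (n + 1) → ℕ)) (w w' : List α) :
    track b s (w ++ w') = track b (track b s w) w' := List.foldl_append

lemma track_add (b : α) (j : ℕ) (x y : Fin (n + 1) → ℕ) (w : List α) :
    track b (j, x + y) w = ((track b (j, x) w).1, (track b (j, x) w).2 + y) := by
  induction w generalizing j x with
  | nil => rfl
  | cons c w ih =>
    simp only [track, List.foldl_cons] at ih ⊢
    by_cases hc : c = b
    · simp only [trackStep, hc, if_true]
      exact ih _ _
    · simp only [trackStep, hc, if_false]
      rw [add_right_comm]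
      exact ih _ _

/-- For a fixed word and starting block `j`, tracking is translation by a fixed vector, hence
expressible by linear equations. -/
lemma track_eq (b : α) (j : ℕ) (x : Fin (n + 1) → ℕ) (w : List α) :
    track b (j, x) w = ((track (n := n) b (j, 0) w).1, (track b (j, 0) w).2 + x) := by
  rw [← track_add, zero_add]

lemma track_replicate {a b : α} (hab : a ≠ b) (j : ℕ) (x : Fin (n + 1) → ℕ) (m : ℕ) :
    track b (j, x) (List.replicate m a) = (j, x + m • fun i => if i.val = j then 1 else 0) := by
  induction m generalizing x with
  | zero => simp [track]
  | succ m ih =>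
    rw [List.replicate_succ, track, List.foldl_cons, ← track, trackStep, if_neg hab, ih, succ_nsmul']
    simp [add_assoc]

end Track

/-! ### Flat schemes and their semilinear reachability relations -/

section Flat

variable {d : ℕ} {α : Type u} {Q : Type v} {V : VASS d α Q}

/-- Firing a fixed sequence of transitions amounts to adding a fixed vector, and is possible above a
fixed threshold. -/
lemma runFrom_iff_or (V : VASS d α Q) (p : List (Transition d α Q)) (q q' : Q) :
    (∀ u u', ¬ V.RunFrom (q, u) p (q', u')) ∨
      ∃ h e₁ e₂ : Fin d → ℕ, ∀ u u', V.RunFrom (q, u) p (q', u') ↔ h ≤ u ∧ u' + e₁ = u + e₂ := by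
  induction p generalizing q with
  | nil =>
    by_cases hq : q = q'
    · subst hq
      refine .inr ⟨0, 0, 0, fun u u' => ⟨?_, ?_⟩⟩
      · rintro ⟨⟩
        simp
      · rintro ⟨-, h⟩
        obtain rfl : u' = u := by simpa using h
        exact .nil _
    · refine .inl fun u u' h => hq ?_
      cases h
      rfl
  | cons t p ih =>
    by_cases ht : t ∈ V.δ ∧ q = t.src
    swap
    · refine .inl fun u u' h => ht ?_
      cases h with
      | cons ht hf _ => exact ⟨ht, hf.1⟩
    obtain ⟨ht, rfl⟩ := ht
    rcases ih t.tgt with ih | ⟨h, e₁, e₂, ih⟩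
    · refine .inl fun u u' h => ?_
      cases h with
      | @cons _ c _ _ _ ht hf hp =>
        obtain ⟨r, w⟩ := c
        obtain rfl : r = t.tgt := hf.2.1
        exact ih _ _ hp
    -- The threshold says that firing `t` keeps the counters nonnegative and reaches the threshold
    -- `h` of the rest. The integer effect is split into negative and positive parts, so that the
    -- equation stays in `ℕ`.
    · refine .inr ⟨fun i => (h i - t.eff i).toNat ⊔ (- t.eff i).toNat,
        fun i => e₁ i + (- t.eff i).toNat,
        fun i => e₂ i + (t.eff i).toNat, fun u u' => ⟨?_, ?_⟩⟩
      · rintro (_ | @⟨_, c, _, _, _, _, hf, hp⟩)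
        obtain ⟨r, w⟩ := c
        obtain rfl : r = t.tgt := hf.2.1
        obtain ⟨h1, h2⟩ := (ih _ _).mp hp
        refine ⟨fun i => ?_, funext fun i => ?_⟩
        · have := h1 i
          have := hf.2.2 i
          simp only [sup_le_iff] at *
          omega
        · have := congrFun h2 i
          have := hf.2.2 i
          simp only [Pi.add_apply] at *
          omega
      · rintro ⟨h1, h2⟩
        have key : ∀ i, h i ≤ (u i + t.eff i).toNat ∧ ((u i + t.eff i).toNat : ℤ) = u i + t.eff i ∧
            u' i + e₁ i = (u i + t.eff i).toNat + e₂ i := by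
          intro i
          have h3 := h1 i
          have h4 := congrFun h2 i
          simp only [Pi.add_apply, sup_le_iff] at h3 h4
          omega
        refine .cons (c' := (t.tgt, fun i => (u i + t.eff i).toNat)) ht
          ⟨rfl, rfl, fun i => (key i).2.1⟩ ((ih _ _).mpr ⟨fun i => (key i).1, ?_⟩)
        exact funext fun i => (key i).2.2

lemma RunFrom.split {c e : Config d Q} {p p' : List (Transition d α Q)}
    (h : V.RunFrom c (p ++ p') e) : ∃ c', V.RunFrom c p c' ∧ V.RunFrom c' p' e := by
  induction p generalizing c with
  | nil => exact ⟨c, .nil _, h⟩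
  | cons t p ih =>
    cases h with
    | cons ht hf h =>
      obtain ⟨c', h1, h2⟩ := ih h
      exact ⟨c', .cons ht hf h1, h2⟩

/-- Iterating a loop: only the first and the last iteration constrain the counters. -/
lemma runFrom_listPow_iff {p : List (Transition d α Q)} {q : Q} {h e₁ e₂ : Fin d → ℕ}
    (hp : ∀ u u', V.RunFrom (q, u) p (q, u') ↔ h ≤ u ∧ u' + e₁ = u + e₂) (m : ℕ)
    (u u' : Fin d → ℕ) :
    V.RunFrom (q, u) (listPow p (m + 1)) (q, u') ↔
      h ≤ u ∧ h + m • e₁ ≤ u + m • e₂ ∧ u' + (m + 1) • e₁ = u + (m + 1) • e₂ := by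
  induction m generalizing u with
  | zero =>
    simp only [listPow_succ, listPow_zero, List.append_nil, hp]
    simp +contextual
  | succ m ih =>
    rw [listPow_succ]
    constructor
    · intro hr
      obtain ⟨⟨r, v⟩, h1, h2⟩ := hr.split
      -- The next copy of `p` begins with the same transition as the first one, so both start in the
      -- source state of that transition.
      obtain rfl : r = q := by
        rcases p with _ | ⟨t, p⟩
        · cases h1; rfl
        · rw [listPow_succ] at h2
          cases h1 with
          | cons _ hf _ =>
            cases h2 with
            | cons _ hf' _ => exact hf'.1.trans hf.1.symm
      rw [hp] at h1
      rw [ih] at h2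
      obtain ⟨h1, h3⟩ := h1
      obtain ⟨h4, h5, h6⟩ := h2
      refine ⟨h1, fun i => ?_, funext fun i => ?_⟩
      · have a1 := congrFun h3 i
        have a2 := h5 i
        simp only [Pi.add_apply, Pi.smul_apply, smul_eq_mul, add_mul, one_mul] at *
        omega
      · have a1 := congrFun h3 i
        have a2 := congrFun h6 i
        simp only [Pi.add_apply, Pi.smul_apply, smul_eq_mul, add_mul, one_mul] at *
        omega
    · rintro ⟨h1, h2, h3⟩
      have key : ∀ i, e₁ i ≤ u i + e₂ i ∧ h i ≤ u i + e₂ i - e₁ i := by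
        intro i
        have a1 := h1 i
        have a2 := h2 i
        have a3 := congrFun h3 i
        simp only [Pi.add_apply, Pi.smul_apply, smul_eq_mul, add_mul, one_mul] at *
        -- A counter that does not decrease stays above `h` because of the first iteration; one that
        -- does not increase does so because of the last.
        rcases le_total (e₁ i) (e₂ i) with hle | hle
        · omega
        · have := Nat.mul_le_mul_left m hle
          omega
      refine RunFrom.append (c' := (q, fun i => u i + e₂ i - e₁ i)) ((hp _ _).mpr ⟨h1, ?_⟩)
        ((ih _).mpr ⟨fun i => (key i).2, fun i => ?_, funext fun i => ?_⟩)
      · funext i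
        have := key i
        simp only [Pi.add_apply]
        omega
      · have := key i
        have a2 := h2 i
        simp only [Pi.add_apply, Pi.smul_apply, smul_eq_mul, add_mul, one_mul] at *
        omega
      · have := key i
        have a3 := congrFun h3 i
        simp only [Pi.add_apply, Pi.smul_apply, smul_eq_mul, add_mul, one_mul] at *
        omega

/-- `V.Follows c ρ R p e`: `p` is a run from `c` to `e` obtained by inserting into `ρ` powers of the
loops `R`. -/
inductive Follows (V : VASS d α Q) : Config d Q → List (Transition d α Q) →
    List (List (Transition d α Q)) → List (Transition d α Q) → Config d Q → Prop
  | nil {q : Q} {u u' : Fin d → ℕ} {π : List (Transition d α Q)} {m : ℕ}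
      (h : V.RunFrom (q, u) (listPow π m) (q, u')) :
      Follows V (q, u) [] [π] (listPow π m) (q, u')
  | cons {q : Q} {u u' : Fin d → ℕ} {π ρ p : List (Transition d α Q)}
      {R : List (List (Transition d α Q))} {m : ℕ} {t : Transition d α Q} {c e : Config d Q}
      (h : V.RunFrom (q, u) (listPow π m) (q, u')) (ht : t ∈ V.δ) (hf : t.Fires (q, u') c)
      (hp : Follows V c ρ R p e) :
      Follows V (q, u) (t :: ρ) (π :: R) (listPow π m ++ t :: p) e

lemma Follows.runFrom {c e : Config d Q} {ρ p : List (Transition d α Q)}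
    {R : List (List (Transition d α Q))} (h : V.Follows c ρ R p e) : V.RunFrom c p e := by
  induction h with
  | nil h => exact h
  | cons h ht hf _ ih => exact h.append (.cons ht hf ih)

variable [DecidableEq α] {n : ℕ}

/-- Counter values together with block lengths. -/
abbrev Values (d n : ℕ) : Type := (Fin d → ℕ) × (Fin (n + 1) → ℕ)

lemma isSemilinearSet_path (V : VASS d α Q) (b : α) (p : List (Transition d α Q)) (q q' : Q)
    (j j' : ℕ) : IsSemilinearSet {z : Values d n × Values d n |
      V.RunFrom (q, z.1.1) p (q', z.2.1) ∧ track b (j, z.1.2) (word p) = (j', z.2.2)} := by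
  rcases runFrom_iff_or V p q q' with h | ⟨h, e₁, e₂, hp⟩
  · simp [h]
  by_cases hj : (track (n := n) b (j, 0) (word p)).1 = j'
  swap
  · convert! IsSemilinearSet.empty using 1
    ext z
    rw [Set.mem_ofPred_eq, track_eq]
    simp [hj]
  let U₁ : Values d n × Values d n →+ (Fin d → ℕ) := (AddMonoidHom.fst _ _).comp (AddMonoidHom.fst _ _)
  let U₂ : Values d n × Values d n →+ (Fin d → ℕ) := (AddMonoidHom.fst _ _).comp (AddMonoidHom.snd _ _)
  let X₁ : Values d n × Values d n →+ (Fin (n + 1) → ℕ) :=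
    (AddMonoidHom.snd _ _).comp (AddMonoidHom.fst _ _)
  let X₂ : Values d n × Values d n →+ (Fin (n + 1) → ℕ) :=
    (AddMonoidHom.snd _ _).comp (AddMonoidHom.snd _ _)
  convert! (isSemilinearSet_setOf_le h 0 0 U₁).inter
    ((isSemilinearSet_setOfPred_eq e₁ e₂ U₂ U₁).inter
      (isSemilinearSet_setOfPred_eq (track (n := n) b (j, 0) (word p)).2 0 X₁ X₂)) using 1
  ext z
  rw [Set.mem_ofPred_eq, track_eq, hp, hj]
  simp [U₁, U₂, X₁, X₂, and_assoc, add_comm]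

lemma isSemilinearSet_loop (V : VASS d α Q) {a b : α} (hab : a ≠ b) {p : List (Transition d α Q)}
    (hpa : ∀ t ∈ p, t.label = some a) (q : Q) (j : ℕ) :
    IsSemilinearSet {z : Values d n × Values d n | ∃ m,
      V.RunFrom (q, z.1.1) (listPow p m) (q, z.2.1) ∧
        track b (j, z.1.2) (word (listPow p m)) = (j, z.2.2)} := by
  have hrefl : IsSemilinearSet {z : Values d n × Values d n | z.1 = z.2} := by
    simpa using isSemilinearSet_setOfPred_eq (0 : Values d n) 0
      (AddMonoidHom.fst (Values d n) (Values d n)) (AddMonoidHom.snd _ _)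
  have hword : ∀ m, word (listPow p m) = List.replicate (m * p.length) a := fun m => by
    rw [word_eq_replicate fun t ht => hpa t (subset_of_mem_listPow ht), length_listPow]
  simp only [hword, track_replicate hab, Prod.mk.injEq, true_and]
  -- If `p` can never loop at `q`, only zero iterations remain and the relation is the diagonal.
  rcases runFrom_iff_or V p q q with h | ⟨h, e₁, e₂, hp⟩
  · convert! hrefl using 1
    ext ⟨⟨u, x⟩, ⟨u', x'⟩⟩
    simp only [Set.mem_ofPred_eq, Prod.mk.injEq]
    constructor
    · rintro ⟨m, h1, h2⟩
      cases m with
      | zero =>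
        cases h1
        simpa using h2
      | succ m =>
        exfalso
        rw [listPow_succ] at h1
        obtain ⟨⟨r, v⟩, h3, h4⟩ := h1.split
        rcases p with _ | ⟨t, p⟩
        · exact h u u (.nil _)
        · obtain rfl : r = q := by
            cases m with
            | zero => cases h4; rfl
            | succ m =>
              rw [listPow_succ] at h4
              cases h3 with
              | cons _ hf _ =>
                cases h4 with
                | cons _ hf' _ => exact hf'.1.trans hf.1.symm
          exact h _ _ h3
    · rintro ⟨rfl, rfl⟩
      exact ⟨0, .nil _, by simp⟩
  · let ξ : Fin (n + 1) → ℕ := p.length • fun i => if i.val = j then 1 else 0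
    let m' : ℕ × (Values d n × Values d n) →+ ℕ := AddMonoidHom.fst _ _
    let U₁ : ℕ × (Values d n × Values d n) →+ (Fin d → ℕ) :=
      ((AddMonoidHom.fst _ _).comp (AddMonoidHom.fst _ _)).comp (AddMonoidHom.snd _ _)
    let U₂ : ℕ × (Values d n × Values d n) →+ (Fin d → ℕ) :=
      ((AddMonoidHom.fst _ _).comp (AddMonoidHom.snd _ _)).comp (AddMonoidHom.snd _ _)
    let X₁ : ℕ × (Values d n × Values d n) →+ (Fin (n + 1) → ℕ) :=
      ((AddMonoidHom.snd _ _).comp (AddMonoidHom.fst _ _)).comp (AddMonoidHom.snd _ _)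
    let X₂ : ℕ × (Values d n × Values d n) →+ (Fin (n + 1) → ℕ) :=
      ((AddMonoidHom.snd _ _).comp (AddMonoidHom.snd _ _)).comp (AddMonoidHom.snd _ _)
    let E₁ := (multiplesHom _ e₁).comp m'
    let E₂ := (multiplesHom _ e₂).comp m'
    -- The iteration number is an extra coordinate, projected away at the end. It stands for one
    -- less than the number of iterations; zero iterations are covered by `hrefl`.
    have hpos := (((isSemilinearSet_setOf_le h 0 0 U₁).inter
      (isSemilinearSet_setOf_le h 0 E₁ (U₁ + E₂))).inter
      ((isSemilinearSet_setOfPred_eq e₁ e₂ (U₂ + E₁) (U₁ + E₂)).inter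
      (isSemilinearSet_setOfPred_eq ξ 0 (X₁ + (multiplesHom _ ξ).comp m') X₂))).image
      (AddMonoidHom.snd ℕ (Values d n × Values d n))
    convert! hrefl.union hpos using 1
    ext ⟨⟨u, x⟩, ⟨u', x'⟩⟩
    simp only [Set.mem_ofPred_eq, Set.mem_union, Prod.mk.injEq, Set.mem_image, Set.mem_inter_iff]
    have hξ : ∀ m : ℕ, (x + ((m + 1) * p.length) • fun i : Fin (n + 1) => if i.val = j then 1 else 0) =
        ξ + (x + m • ξ) := fun m => by
      rw [mul_nsmul', succ_nsmul']
      simp only [ξ]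
      abel
    constructor
    · rintro ⟨m, h1, h2⟩
      cases m with
      | zero =>
        cases h1
        exact .inl ⟨rfl, by simpa using h2⟩
      | succ m =>
        rw [runFrom_listPow_iff hp] at h1
        rw [hξ] at h2
        obtain ⟨h1, h3, h4⟩ := h1
        refine .inr ⟨(m, (u, x), (u', x')), ⟨⟨?_, ?_⟩, ?_, ?_⟩, rfl⟩
        · simpa [U₁] using h1
        · simpa [U₁, E₁, E₂, m'] using h3
        · simp only [succ_nsmul] at h4
          simp [U₁, U₂, E₁, E₂, m', -nsmul_eq_mul]
          rw [add_comm e₁, add_comm e₂, add_assoc, add_assoc, h4]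
        · simpa [X₁, X₂, m'] using h2
    · rintro (⟨rfl, rfl⟩ | ⟨⟨m, ⟨u₁, x₁⟩, ⟨u₂, x₂⟩⟩, ⟨⟨h1, h2⟩, h3, h4⟩, h5⟩)
      · exact ⟨0, .nil _, by simp⟩
      · obtain ⟨⟨rfl, rfl⟩, rfl, rfl⟩ := by simpa using h5
        refine ⟨m + 1, (runFrom_listPow_iff hp _ _ _).mpr ⟨?_, ?_, ?_⟩, ?_⟩
        · simpa [U₁] using h1
        · simpa [U₁, E₁, E₂, m'] using h2
        · simp [U₁, U₂, E₁, E₂, m', -nsmul_eq_mul] at h3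
          simp only [succ_nsmul]
          rw [add_comm e₁, add_comm e₂, add_assoc, add_assoc] at h3
          exact h3
        · rw [hξ]
          simpa [X₁, X₂, m'] using h4

/-- Induction along `ρ`: compose the relations of one iterated loop, one transition, and the
remaining scheme. The current block index is not a coordinate: loops preserve it and each transition
of `ρ` changes it by a fixed amount. -/
lemma isSemilinearSet_follows (V : VASS d α Q) {a b : α} (hab : a ≠ b)
    (ρ : List (Transition d α Q)) (R : List (List (Transition d α Q)))
    (hR : ∀ π ∈ R, ∀ t ∈ π, t.label = some a) (q q' : Q) (j j' : ℕ) :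
    IsSemilinearSet {z : Values d n × Values d n | ∃ p,
      V.Follows (q, z.1.1) ρ R p (q', z.2.1) ∧ track b (j, z.1.2) (word p) = (j', z.2.2)} := by
  have hpow : ∀ π : List (Transition d α Q), (∀ t ∈ π, t.label = some a) → ∀ m j
      (x : Fin (n + 1) → ℕ), (track b (j, x) (word (listPow π m))).1 = j := by
    intro π hπ m j x
    rw [word_eq_replicate fun t ht => hπ t (subset_of_mem_listPow ht), track_replicate hab]
  induction ρ generalizing q j R with
  | nil =>
    by_cases hlen : ∃ π, R = [π]
    swap
    · convert! IsSemilinearSet.empty using 1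
      ext z
      simp only [Set.mem_ofPred_eq, Set.mem_empty_iff_false, iff_false]
      rintro ⟨p, h, -⟩
      generalize hc : (q, z.1.1) = c at h
      generalize he : (q', z.2.1) = e at h
      cases h with
      | nil h => exact hlen ⟨_, rfl⟩
    obtain ⟨π, rfl⟩ := hlen
    by_cases hqj : q = q' ∧ j = j'
    · obtain ⟨rfl, rfl⟩ := hqj
      convert! isSemilinearSet_loop (n := n) V hab (hR π (by simp)) q j using 1
      ext z
      constructor
      · rintro ⟨p, h, ht⟩
        cases h with
        | @nil _ _ _ _ m h => exact ⟨m, h, ht⟩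
      · rintro ⟨m, h, ht⟩
        exact ⟨_, .nil h, ht⟩
    · convert! IsSemilinearSet.empty using 1
      ext z
      simp only [Set.mem_ofPred_eq, Set.mem_empty_iff_false, iff_false]
      rintro ⟨p, h, ht⟩
      generalize he : (q', z.2.1) = e at h
      cases h with
      | @nil _ _ _ _ m h =>
        refine hqj ⟨(Prod.ext_iff.mp he).1.symm, ?_⟩
        have := hpow π (hR π (by simp)) m j z.1.2
        rw [ht] at this
        exact this.symm
  | cons t ρ ih =>
    by_cases hlen : ∃ π R', R = π :: R'
    swap
    · convert! IsSemilinearSet.empty using 1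
      ext z
      simp only [Set.mem_ofPred_eq, Set.mem_empty_iff_false, iff_false]
      rintro ⟨p, h, -⟩
      generalize hc : (q, z.1.1) = c at h
      generalize he : (q', z.2.1) = e at h
      cases h with
      | cons h => exact hlen ⟨_, _, rfl⟩
    obtain ⟨π, R, rfl⟩ := hlen
    set j₁ := (track (n := n) b (j, 0) (word [t])).1 with hj₁
    convert! (isSemilinearSet_loop (n := n) V hab (hR π (by simp)) q j).comp
      ((isSemilinearSet_path V b [t] q t.tgt j j₁).comp
        (ih R (fun π hπ => hR π (by simp [hπ])) t.tgt j₁)) using 1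
    ext z
    constructor
    · rintro ⟨p, h, ht⟩
      generalize he : (q', z.2.1) = e at h
      cases h with
      | @cons _ _ u' _ _ p _ m _ c _ h htδ hf hp =>
        subst he
        obtain ⟨r, u₁⟩ := c
        obtain rfl : r = t.tgt := hf.2.1
        rw [word_append, word_cons, track_append, track_append] at ht
        have h1 := hpow π (hR π (by simp)) m j z.1.2
        set s := track b (j, z.1.2) (word (listPow π m)) with hs
        have hs' : s = (j, s.2) := Prod.ext h1 rfl
        rw [hs', track_eq b j s.2 (word [t])] at ht
        refine ⟨(u', s.2), ⟨m, h, hs'⟩, (u₁, (track b (j, 0) (word [t])).2 + s.2),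
          ⟨.cons htδ hf (.nil _), ?_⟩, p, hp, ht⟩
        exact track_eq _ _ _ _
    · rintro ⟨⟨u', x⟩, ⟨m, h, hx⟩, ⟨u₁, x₁⟩, ⟨h1, hx₁⟩, p, hp, ht⟩
      refine ⟨listPow π m ++ t :: p, ?_, ?_⟩
      · cases h1 with
        | cons htδ hf h1 =>
          cases h1
          exact .cons h htδ hf hp
      · rw [word_append, word_cons, track_append, track_append, hx, hx₁, ht]

end Flat

end VASS

namespace VASS

/-! ### Block words and their length vectors -/

section Blocks

variable {α : Type u} [DecidableEq α]

/-- Stated for any starting block `j`, so that the induction can advance past each separator. There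
is one separator fewer than blocks, whence the `- 1`; the default `0` serves indices beyond the
list. -/
lemma track_intercalate {a b : α} (hab : a ≠ b) {n : ℕ} (l : List ℕ) (hl : l ≠ []) (j : ℕ)
    (x : Fin (n + 1) → ℕ) :
    track b (j, x) (List.intercalate [b] (l.map fun m => List.replicate m a)) =
      (j + l.length - 1, fun i => x i + if j ≤ i then l.getD (i - j) 0 else 0) := by
  induction l generalizing j x with
  | nil => exact absurd rfl hl
  | cons m l ih =>
    cases l with
    | nil =>
      simp only [List.map_cons, List.map_nil, List.intercalate_singleton, track_replicate hab]
      refine Prod.ext rfl (funext fun i => ?_)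
      simp only [Pi.add_apply, Pi.smul_apply, smul_eq_mul]
      rcases lt_trichotomy i.val j with h | h | h
      · rw [if_neg h.ne, if_neg (by omega)]; rfl
      · simp [h]
      · rw [if_neg h.ne', if_pos h.le, List.getD_eq_default _ _ (by simp; omega)]; rfl
    | cons m' l =>
      rw [List.map_cons, List.map_cons, List.intercalate_cons_cons, track_append, track_append,
        track_replicate hab, ← List.map_cons (f := fun m => List.replicate m a)]
      have hstep : ∀ y : Fin (n + 1) → ℕ, track b (j, y) [b] = (j + 1, y) := fun y => by
        simp [track, trackStep]
      rw [hstep, ih (by simp)]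
      refine Prod.ext (by simp; omega) (funext fun i => ?_)
      simp only [Pi.add_apply, Pi.smul_apply, smul_eq_mul]
      rcases lt_trichotomy i.val j with h | h | h
      · rw [if_neg h.ne, if_neg (by omega), if_neg (by omega)]; rfl
      · simp [h]
      · rw [if_neg h.ne', if_pos h.le, if_pos (by omega)]
        obtain ⟨r, hr⟩ := Nat.exists_eq_add_of_lt h
        have h1 : i.val - (j + 1) = r := by omega
        have h2 : i.val - j = r + 1 := by omega
        rw [h1, h2, List.getD_cons_succ]
        simp

lemma track_blockWord {a b : α} (hab : a ≠ b) {n : ℕ} (x : Fin (n + 1) → ℕ) :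
    track b (0, 0) (blockWord a b x) = (n, x) := by
  have h : blockWord a b x =
      List.intercalate [b] ((List.ofFn x).map fun m => List.replicate m a) := by
    rw [blockWord, List.map_ofFn]; rfl
  rw [h, track_intercalate hab _ (by simp)]
  refine Prod.ext (by simp) (funext fun i => ?_)
  have hi : i.val < (List.ofFn x).length := by rw [List.length_ofFn]; exact i.isLt
  simp only [Pi.zero_apply, zero_add, zero_le, if_true, tsub_zero, List.getD_eq_getElem _ _ hi,
    List.getElem_ofFn]

lemma exists_eq_blockWord {a b : α} (hab : a ≠ b) (w : List α) (hw : ∀ c ∈ w, c = a ∨ c = b)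
    (n : ℕ) (hn : w.count b = n) : ∃ x : Fin (n + 1) → ℕ, w = blockWord a b x := by
  suffices h : ∃ l : List ℕ, l.length = n + 1 ∧
      w = List.intercalate [b] (l.map fun m => List.replicate m a) by
    obtain ⟨l, hl, rfl⟩ := h
    refine ⟨fun i => l[i], ?_⟩
    rw [blockWord]
    congr 1
    apply List.ext_getElem
    · simp [hl]
    · intro i h1 h2
      simp only [List.getElem_map, List.getElem_ofFn, Fin.getElem_fin]
  induction w generalizing n with
  | nil =>
    obtain rfl : 0 = n := by simpa using hn
    exact ⟨[0], rfl, by simp⟩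
  | cons c w ih =>
    have ih := ih (fun c hc => hw c (by simp [hc]))
    rcases hw c (by simp) with rfl | rfl
    · obtain ⟨l, hl, hlw⟩ := ih n (by rwa [List.count_cons_of_ne hab] at hn)
      match l, hl with
      | m :: l, hl =>
        refine ⟨(m + 1) :: l, hl, ?_⟩
        rw [hlw]
        cases l <;> simp [List.replicate_succ, List.intercalate_cons_cons]
    · rw [List.count_cons_self] at hn
      obtain ⟨l, hl, hlw⟩ := ih (n - 1) (by omega)
      match l, hl with
      | m :: l, hl =>
        refine ⟨0 :: m :: l, by simp at hl ⊢; omega, ?_⟩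
        rw [hlw]
        simp [List.intercalate_cons_cons]

/-- This replaces equality with a block word by the condition on `track` used in the semilinear
relations. -/
lemma eq_blockWord_iff {a b : α} (hab : a ≠ b) {n : ℕ} {w : List α} (hw : ∀ c ∈ w, c = a ∨ c = b)
    (hn : w.count b = n) (x : Fin (n + 1) → ℕ) :
    w = blockWord a b x ↔ track b (0, 0) w = (n, x) := by
  constructor
  · rintro rfl
    exact track_blockWord hab x
  · intro h
    obtain ⟨y, rfl⟩ := exists_eq_blockWord hab w hw n hn
    rw [track_blockWord hab] at h
    rw [(Prod.mk.inj h).2]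

end Blocks

/-! ### From extensions to flat schemes, and the main theorem -/

section Main

variable {d : ℕ} {α : Type u} {Q : Type v} {V : VASS d α Q}

/-- The scheme forgets that the run stays above the configurations of `ρ`; only the loop words and
the states matter from here on. -/
lemma Ext.follows {c e : Config d Q} {ρ : List (Transition d α Q)} {v w : Fin d → ℕ}
    {S R : List (List (Transition d α Q))} (h : V.Ext c ρ e v S w)
    (hR : List.Forall₂ (fun π s => ∃ m, s = listPow π m) R S) :
    V.Follows (c.1, c.2 + v) ρ R (weave ρ S) (e.1, e.2 + w) := by
  induction h generalizing R with
  | nil hs =>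
    obtain _ | ⟨⟨m, rfl⟩, hR⟩ := hR
    cases hR
    exact .nil hs
  | cons hs ht hf _ ih =>
    obtain _ | ⟨⟨m, rfl⟩, hR⟩ := hR
    exact .cons hs ht (hf.add _) (ih hR)

/-- All extensions of an accepting run follow one flat scheme. -/
lemma exists_flat_scheme [DecidableEq α] {a b : α} {n k : ℕ} (hk : V.IsAmbiguous k)
    (hε : V.EpsilonFree) (hab : ∀ w ∈ V.language, ∀ x ∈ w, x = a ∨ x = b)
    (hn : ∀ w ∈ V.language, w.count b = n) {c e : Config d Q} {ρ : List (Transition d α Q)}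
    (hc : c ∈ V.I) (he : V.IsAcceptingConfig e) :
    ∃ R : List (List (Transition d α Q)), (∀ π ∈ R, ∀ t ∈ π, t.label = some a) ∧
      ∀ S w, V.Ext c ρ e 0 S w → V.Follows c ρ R (weave ρ S) (e.1, e.2 + w) := by
  obtain ⟨R, hR, hRS⟩ := exists_common_roots (ρ.length + 1) {S | ∃ w, V.Ext c ρ e 0 S w}
    (fun S ⟨w, h⟩ => h.length)
    (fun S ⟨w, h⟩ S' ⟨w', h'⟩ => h.zipWith_append_comm hk hε hab hn hc he h')
  refine ⟨R, fun π hπ t ht => ?_, fun S w h => ?_⟩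
  · obtain ⟨S, ⟨w, h⟩, s, hs, hts⟩ := hR π hπ t ht
    exact h.label_eq hε hab hn hc he s hs t hts
  · simpa using h.follows (hRS S ⟨w, h⟩)

/-- The block lengths of the accepting runs that follow a flat scheme form a semilinear set. -/
lemma isSemilinearSet_follows_accepting [DecidableEq α] (V : VASS d α Q) {a b : α} (hab : a ≠ b)
    {n : ℕ} (ρ : List (Transition d α Q)) (R : List (List (Transition d α Q)))
    (hR : ∀ π ∈ R, ∀ t ∈ π, t.label = some a) (c f : Config d Q) :
    IsSemilinearSet {x : Fin (n + 1) → ℕ | ∃ p u, V.Follows c ρ R p (f.1, u) ∧ f.2 ≤ u ∧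
      track b (0, 0) (word p) = (n, x)} := by
  let π₁ : Values d n × Values d n →+ Values d n := AddMonoidHom.fst _ _
  let u₂ : Values d n × Values d n →+ (Fin d → ℕ) :=
    (AddMonoidHom.fst _ _).comp (AddMonoidHom.snd _ _)
  let x₂ : Values d n × Values d n →+ (Fin (n + 1) → ℕ) :=
    (AddMonoidHom.snd _ _).comp (AddMonoidHom.snd _ _)
  convert! (((isSemilinearSet_follows (n := n) V hab ρ R hR c.1 f.1 0 n).inter
    ((IsSemilinearSet.singleton (c.2, 0)).preimage π₁)).inter
    (isSemilinearSet_setOf_le f.2 0 0 u₂)).image x₂ using 1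
  ext x
  constructor
  · rintro ⟨p, u, h, hf, ht⟩
    exact ⟨((c.2, 0), (u, x)), ⟨⟨⟨p, h, ht⟩, rfl⟩, by simpa [u₂] using hf⟩, rfl⟩
  · rintro ⟨⟨z, u, x⟩, ⟨⟨⟨p, h, ht⟩, hz⟩, hf⟩, rfl⟩
    obtain rfl : z = (c.2, 0) := hz
    exact ⟨p, u, h, by simpa [u₂] using hf, ht⟩

end Main

end VASS

theorem mainTheorem5 {α : Type u} {Q : Type v} [Finite α] [DecidableEq α] [Finite Q] {d : ℕ}
    (V : VASS d α Q) (hε : V.EpsilonFree) (k : ℕ) (hk : V.IsAmbiguous k)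
    (a b : α) (hab : a ≠ b)
    (L : Language α) (hL : V.language = L)
    (hLab : ∀ w ∈ L, ∀ c ∈ w, c = a ∨ c = b)
    (n : ℕ) (hn : ∀ w ∈ L, w.count b = n) :
    IsSemilinearSet (VASS.im a b n L) := by
  classical
  subst hL
  choose B hB hBext using fun c₀ => VASS.exists_finite_basis V c₀
  have key : ∀ c₀ ∈ V.I, ∀ ρ ∈ B c₀, ∃ X : Set (Fin (n + 1) → ℕ), IsSemilinearSet X ∧
      X ⊆ VASS.im a b n V.language ∧
      ∀ ρ' e', V.IsAcceptingConfig e' → (∀ e, V.RunFrom c₀ ρ e →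
        ∃ S w, V.Ext c₀ ρ e 0 S w ∧ ρ' = VASS.weave ρ S ∧ e' = (e.1, e.2 + w)) →
        ∀ x, VASS.word ρ' = VASS.blockWord a b x → x ∈ X := by
    intro c₀ hc₀ ρ hρ
    obtain ⟨e, he, f, hf, hfe, hle⟩ := hB c₀ ρ hρ
    have hacc : V.IsAcceptingConfig e := ⟨f, hf, hfe, hle⟩
    obtain ⟨R, hR, hflat⟩ := VASS.exists_flat_scheme (ρ := ρ) hk hε hLab hn hc₀ hacc
    refine ⟨_, VASS.isSemilinearSet_follows_accepting (n := n) V hab ρ R hR c₀ f, ?_, ?_⟩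
    -- A run following the scheme need not extend `ρ`, but it starts in `c₀` and covers `f`. It is
    -- thus accepting, so the scheme contributes no vectors outside `im(L)`.
    · rintro x ⟨p, u, hp, hfu, ht⟩
      have hmem : VASS.word p ∈ V.language :=
        ⟨p, ⟨c₀, hc₀, _, hp.runFrom, f, hf, rfl, hfu⟩, rfl⟩
      have hw := (VASS.eq_blockWord_iff hab (hLab _ hmem) (hn _ hmem) x).mpr ht
      show VASS.blockWord a b x ∈ V.language
      rwa [← hw]
    · intro ρ' e' he' h x hx
      obtain ⟨S, w, hS, rfl, rfl⟩ := h e he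
      refine ⟨_, e.2 + w, hfe ▸ hflat S w hS, hle.trans le_self_add, ?_⟩
      rw [hx]
      exact VASS.track_blockWord hab x
  choose! X hX hXsub hXmem using key
  have hunion : VASS.im a b n V.language = ⋃ c₀ ∈ V.I, ⋃ ρ ∈ B c₀, X c₀ ρ := by
    ext x
    simp only [Set.mem_iUnion, exists_prop]
    constructor
    · rintro ⟨ρ', ⟨c₀, hc₀, e', hρ', he'⟩, hx⟩
      obtain ⟨ρ, hρ, h⟩ := hBext c₀ ρ' e' hρ' he'
      exact ⟨c₀, hc₀, ρ, hρ, hXmem c₀ hc₀ ρ hρ ρ' e' he' h x hx⟩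
    · rintro ⟨c₀, hc₀, ρ, hρ, hx⟩
      exact hXsub c₀ hc₀ ρ hρ hx
  rw [hunion]
  exact .biUnion_finset fun c₀ hc₀ => .biUnion_finset fun ρ hρ => hX c₀ hc₀ ρ hρ
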